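/- Consider a leader $x_r(k+1)=Sx_r(k)$, $y_r(k)=Rx_r(k)$ with known $S\in\mathbb{R}^{r\times r}$, $R\in\mathbb{R}^{p\times r}$, and $N$ followers $x_i(k+1)=\bar A_ix_i(k)+\bar B_iu_i(k)$, $y_i(k)=C_ix_i(k)+D_iu_i(k)$, $i=1,\dots,N$, with $x_i(k)\in\mathbb{R}^{n_i}$, $n_i\ge 1$, $u_i(k)\in\mathbb{R}^{m_i}$, known $C_i,D_i$ and unknown $\bar A_i,\bar B_i$. From each follower one has the data $U_{i-}=[u_i(0)\ \cdots\ u_i(\tau-1)]$ and $X_i=[x_i(0)\ \cdots\ x_i(\tau)]$; put $X_{i-}=[x_i(0)\ \cdots\ x_i(\tau-1)]$ and $X_{i+}=[x_i(1)\ \cdots\ x_i(\tau)]$, so that $X_{i+}=\bar A_iX_{i-}+\bar B_iU_{i-}$. Let $\Sigma_i$ be the set of all $(A_i,B_i)$ with $X_{i+}=A_iX_{i-}+B_iU_{i-}$. Let $\mathcal{A}=[a_{ij}]$ be the nonnegative adjacency matrix of the weighted directed communication graph between the followers ($a_{ji}\neq0$ iff $(i,j)$ is an edge), $d_i=\sum_j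 a_{ij}$, $\mathcal{D}=\mathrm{diag}(d_1,\dots,d_N)$, $L=\mathcal{D}-\mathcal{A}$, and let $g_i\ge 0$ be the weight with which the leader shares its state with follower $i$, $G=\mathrm{diag}(g_1,\dots,g_N)$. A protocol is given by matrices $F,K_i,\Pi_i,\Gamma_i$ and reads $$v_i(k+1)=Sv_i(k)+(1+d_i+g_i)^{-1}F\Big(\sum_{j=1}^N a_{ij}\big(v_j(k)-v_i(k)\big)+g_i\big(x_r(k)-v_i(k)\big)\Big),$$ $$u_i(k)=K_i\big(x_i(k)-\Pi_iv_i(k)\big)+\Gamma_iv_i(k).$$ It achieves output synchronization for followers $(A_i,B_i)$ if, for all initial states and all $i$, $y_i(k)-y_r(k)\to0$, $v_i(k)-x_r(k)\to0$ and $x_i(k)-\Pi_iv_i(k)\to0$ as $k\to\infty$. The data $(U_{i-},X_i)$, $i=1,\dots,N$, are informative for output synchronization if there is a single protocol that achieves output synchronization for all choices of $(A_i,B_i)\in\Sigma_i$, $i=1,\dots,N$. A square matrix is stable if all its eigenvalues lie in the open unit disc. Assume that (1) all eigenvalues of $S$ are simple and lie on the unit circle, and (2) the communication graph between the followers has no self-loops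 and contains a directed spanning tree, and $g_i>0$ for at least one node $i$ that is the root of a spanning tree. Then the data $(U_{i-},X_i)$ are informative for output synchronization if and only if, for each $i=1,\dots,N$, there is a right inverse $X_{i-}^\dagger$ of $X_{i-}$ such that $X_{i+}X_{i-}^\dagger$ is stable, and there is a matrix $M_i$ with $$X_{i+}M_i-X_{i-}M_iS=0,\qquad C_iX_{i-}M_i+D_iU_{i-}M_i=R.$$ In this case a protocol can be found as follows. There exist matrices $F$ such that $S-\lambda F$ is stable for every eigenvalue $\lambda$ of $(I_N+\mathcal{D}+G)^{-1}(L+G)$; for any such $F$ and any $X_{i-}^\dagger$, $M_i$ as above, the protocol with this $F$ and $K_i=U_{i-}X_{i-}^\dagger$, $\Pi_i=X_{i-}M_i$, $\Gamma_i=U_{i-}M_i$ achieves output synchronization for all $(A_i,B_i)\in\Sigma_i$, $i=1,\dots,N$. -/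

import Mathlib

open Filter Topology

/-- A square complex matrix is (Schur) stable if all its eigenvalues lie in the open unit disc. -/
def IsSchurStable {d : ℕ} (A : Matrix (Fin d) (Fin d) ℂ) : Prop :=
  ∀ z ∈ spectrum ℂ A, ‖z‖ < 1

/-- A real matrix, regarded as a complex matrix. -/
def toComplex {a b : ℕ} (A : Matrix (Fin a) (Fin b) ℝ) : Matrix (Fin a) (Fin b) ℂ :=
  A.map Complex.ofReal

/-- All (complex) eigenvalues of `S` are simple, as roots of the characteristic polynomial, and
lie on the unit circle. -/
def EigenvaluesSimpleOnUnitCircle {r : ℕ} (S : Matrix (Fin r) (Fin r) ℝ) : Prop :=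
  ∀ z ∈ spectrum ℂ (toComplex S),
    (toComplex S).charpoly.rootMultiplicity z = 1 ∧ ‖z‖ = 1

/-- A weighted directed graph on `N` nodes, given by its adjacency matrix `[a_{ij}]`, which has
nonnegative entries. -/
structure WeightedDigraph (N : ℕ) where
  adj : Matrix (Fin N) (Fin N) ℝ
  adj_nonneg : ∀ i j, 0 ≤ adj i j

namespace WeightedDigraph

variable {N : ℕ} (G : WeightedDigraph N)

/-- `(i, j)` is an edge iff its weight `a_{ji}` is nonzero. -/
def Edge (i j : Fin N) : Prop := G.adj j i ≠ 0

/-- No self-loops. -/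
def IsSimple : Prop := ∀ i, G.adj i i = 0

/-- The degree `d_i = ∑_j a_{ij}`. -/
def degree (i : Fin N) : ℝ := ∑ j, G.adj i j

/-- The degree matrix `diag(d_1, …, d_N)`. -/
def degreeMatrix : Matrix (Fin N) (Fin N) ℝ := Matrix.diagonal G.degree

/-- The Laplacian matrix. -/
def laplacian : Matrix (Fin N) (Fin N) ℝ := G.degreeMatrix - G.adj

/-- The edge relation `T` is a spanning tree of `G` with root `root`: all its edges are edges of
`G`, the root has in-degree zero, every other node has in-degree one, and all nodes are connected
(by a directed path of `T` from the root). -/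
structure IsSpanningTree (T : Fin N → Fin N → Prop) (root : Fin N) : Prop where
  edge : ∀ i j, T i j → G.Edge i j
  root_indegree : ∀ i, ¬ T i root
  indegree : ∀ j, j ≠ root → ∃! i, T i j
  reachable : ∀ j, Relation.ReflTransGen T root j

end WeightedDigraph

/-- The known part of a leader-follower multi-agent system with `N` followers, followers' state
and input dimensions `n i`, `m i`, leader's state dimension `r` and output dimension `p`:
leader `x_r(k+1) = S x_r(k)`, `y_r = R x_r`; follower outputs `y_i = C_i x_i + D_i u_i`;
communication graph among the followers, and the weights `g_i ≥ 0` with which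
the leader shares its state with follower `i`. -/
structure LeaderFollowerNetwork (N r p : ℕ) (n m : Fin N → ℕ) where
  S : Matrix (Fin r) (Fin r) ℝ
  R : Matrix (Fin p) (Fin r) ℝ
  C : ∀ i, Matrix (Fin p) (Fin (n i)) ℝ
  D : ∀ i, Matrix (Fin p) (Fin (m i)) ℝ
  graph : WeightedDigraph N
  g : Fin N → ℝ
  g_nonneg : ∀ i, 0 ≤ g i

/-- The matrices to be chosen in the protocol: the common gain `F` and, for each follower,
`K_i`, `Π_i` (here `Pi i`) and `Γ_i` (here `Gam i`). -/
structure Protocol (N r : ℕ) (n m : Fin N → ℕ) where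
  F : Matrix (Fin r) (Fin r) ℝ
  K : ∀ i, Matrix (Fin (m i)) (Fin (n i)) ℝ
  Pi : ∀ i, Matrix (Fin (n i)) (Fin r) ℝ
  Gam : ∀ i, Matrix (Fin (m i)) (Fin r) ℝ

/-- `X_-`: the state data without the last column. -/
def pastStates {d τ : ℕ} (X : Matrix (Fin d) (Fin (τ + 1)) ℝ) : Matrix (Fin d) (Fin τ) ℝ :=
  X.submatrix id Fin.castSucc

/-- `X_+`: the state data without the first column. -/
def futureStates {d τ : ℕ} (X : Matrix (Fin d) (Fin (τ + 1)) ℝ) : Matrix (Fin d) (Fin τ) ℝ :=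
  X.submatrix id Fin.succ

/-- The set of all systems `(A, B)` that explain the input-state data `(U_-, X)`. -/
def explainingSystems {d e τ : ℕ} (U : Matrix (Fin e) (Fin τ) ℝ)
    (X : Matrix (Fin d) (Fin (τ + 1)) ℝ) :
    Set (Matrix (Fin d) (Fin d) ℝ × Matrix (Fin d) (Fin e) ℝ) :=
  {AB | futureStates X = AB.1 * pastStates X + AB.2 * U}

namespace LeaderFollowerNetwork

variable {N r p : ℕ} {n m : Fin N → ℕ} (net : LeaderFollowerNetwork N r p n m)

/-- The followers' graph is simple and contains a spanning tree, and the leader shares its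
information with at least one root node, i.e. with the root of some spanning tree. -/
def CommunicationAssumption : Prop :=
  net.graph.IsSimple ∧ ∃ T root, net.graph.IsSpanningTree T root ∧ 0 < net.g root

/-- The matrix `(I + 𝒟 + G)⁻¹ (L + G)` with `G = diag(g_1, …, g_N)`. -/
noncomputable def couplingMatrix : Matrix (Fin N) (Fin N) ℝ :=
  (1 + net.graph.degreeMatrix + Matrix.diagonal net.g)⁻¹ *
    (net.graph.laplacian + Matrix.diagonal net.g)

/-- `S - λ F` is stable for every eigenvalue `λ` of `(I + 𝒟 + G)⁻¹ (L + G)`. -/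
def IsStabilizingGain (F : Matrix (Fin r) (Fin r) ℝ) : Prop :=
  ∀ z ∈ spectrum ℂ (toComplex net.couplingMatrix),
    IsSchurStable (toComplex net.S - z • toComplex F)

/-- The sequences `xr`, `x`, `u`, `v` (leader state, follower states, follower inputs, controller
states) form a trajectory of the leader and the followers `x_i(k+1) = A_i x_i(k) + B_i u_i(k)`,
interconnected by the protocol `P`. The initial states are arbitrary. -/
structure IsTrajectory (P : Protocol N r n m)
    (A : ∀ i, Matrix (Fin (n i)) (Fin (n i)) ℝ) (B : ∀ i, Matrix (Fin (n i)) (Fin (m i)) ℝ)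
    (xr : ℕ → Fin r → ℝ) (x : ∀ i, ℕ → Fin (n i) → ℝ) (u : ∀ i, ℕ → Fin (m i) → ℝ)
    (v : Fin N → ℕ → Fin r → ℝ) : Prop where
  leader : ∀ k, xr (k + 1) = net.S.mulVec (xr k)
  follower : ∀ i k, x i (k + 1) = (A i).mulVec (x i k) + (B i).mulVec (u i k)
  controller : ∀ i k, v i (k + 1) = net.S.mulVec (v i k) +
    (1 + net.graph.degree i + net.g i)⁻¹ • P.F.mulVec
      ((∑ j, net.graph.adj i j • (v j k - v i k)) + net.g i • (xr k - v i k))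
  input : ∀ i k, u i k =
    (P.K i).mulVec (x i k - (P.Pi i).mulVec (v i k)) + (P.Gam i).mulVec (v i k)

/-- The protocol `P` achieves output synchronization for the leader and the followers `(A_i, B_i)`:
along all trajectories, `y_i - y_r`, `v_i - x_r` and `x_i - Π_i v_i` tend to zero. -/
def AchievesOutputSync (P : Protocol N r n m)
    (A : ∀ i, Matrix (Fin (n i)) (Fin (n i)) ℝ)
    (B : ∀ i, Matrix (Fin (n i)) (Fin (m i)) ℝ) : Prop :=
  ∀ xr x u v, net.IsTrajectory P A B xr x u v → ∀ i,
    Tendsto (fun k => ((net.C i).mulVec (x i k) + (net.D i).mulVec (u i k))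
      - net.R.mulVec (xr k)) atTop (𝓝 0) ∧
    Tendsto (fun k => v i k - xr k) atTop (𝓝 0) ∧
    Tendsto (fun k => x i k - (P.Pi i).mulVec (v i k)) atTop (𝓝 0)

/-- The protocol `P` achieves output synchronization for the leader and all follower systems that
explain the data. -/
def AchievesOutputSyncForData {τ : ℕ} (U : ∀ i, Matrix (Fin (m i)) (Fin τ) ℝ)
    (X : ∀ i, Matrix (Fin (n i)) (Fin (τ + 1)) ℝ) (P : Protocol N r n m) : Prop :=
  ∀ A B, (∀ i, (A i, B i) ∈ explainingSystems (U i) (X i)) → net.AchievesOutputSync P A B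

/-- The data `(U_{i-}, X_i)` are informative for output synchronization. -/
def InformativeForOutputSync {τ : ℕ} (U : ∀ i, Matrix (Fin (m i)) (Fin τ) ℝ)
    (X : ∀ i, Matrix (Fin (n i)) (Fin (τ + 1)) ℝ) : Prop :=
  ∃ P : Protocol N r n m, net.AchievesOutputSyncForData U X P

end LeaderFollowerNetwork

/-- `Xd` is a right inverse of `X_-` such that `X_+ Xd` is stable. -/
def IsStabilizingRightInverse {d τ : ℕ} (X : Matrix (Fin d) (Fin (τ + 1)) ℝ)
    (Xd : Matrix (Fin τ) (Fin d) ℝ) : Prop :=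
  pastStates X * Xd = 1 ∧ IsSchurStable (toComplex (futureStates X * Xd))

/-- `M` solves `X_+ M - X_- M S = 0` and `C X_- M + D U_- M = R`. -/
def SolvesDataRegulatorEquations {d e r p τ : ℕ} (S : Matrix (Fin r) (Fin r) ℝ)
    (R : Matrix (Fin p) (Fin r) ℝ) (C : Matrix (Fin p) (Fin d) ℝ) (D : Matrix (Fin p) (Fin e) ℝ)
    (U : Matrix (Fin e) (Fin τ) ℝ) (X : Matrix (Fin d) (Fin (τ + 1)) ℝ)
    (M : Matrix (Fin τ) (Fin r) ℝ) : Prop :=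
  futureStates X * M - pastStates X * M * S = 0 ∧
    C * pastStates X * M + D * U * M = R

/-! Sufficiency is a cascade argument. The observer errors `v_j - x_r` evolve autonomously, and on
the joint eigenvectors of their dynamics and of the coupling the matrix acting is `S - λ F`. If
the regulator equations hold, these errors are the only input of the regulation error
`x_i - Π_i v_i`, whose own dynamics is `A_i + B_i K_i`. For the data-driven gains this matrix is
`X_+ X_-^†`, and the regulator equations are the given ones for `M_i`. The choice `F = S` works
because `S - λ S` is `(1 - λ) S` and `1 - (I + 𝒟 + G)⁻¹ (L + G)` is substochastic, with a path
from every node to a row of sum less than one.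

For necessity, consider trajectories with `v_i = x_r`: the defects of the regulator equations,
applied to `S ^ k w`, must tend to zero, hence vanish because no eigenvalue of `S` is inside the
unit disc. These conclusions hold for all systems explaining the data. If `a X_- + b U_- = 0`,
then `(A + W a, B + W b)` explains the data for every `W`, and boundedness of the trace of a
stable matrix forces `a + b K = 0`; likewise `a Π + b Γ = 0`. By duality `(I, K)` and `(Π, Γ)`
factor through `(X_-, U_-)`. -/

section StableSubspace

variable {𝕜 V : Type*} [NontriviallyNormedField 𝕜] [AddCommGroup V] [Module 𝕜 V]
  [TopologicalSpace V] [IsTopologicalAddGroup V] [ContinuousSMul 𝕜 V]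

/-- The stable subspace of the discrete-time system `x (k + 1) = f (x k)`: the initial states whose
orbit converges to zero. -/
def stableSubspace (f : Module.End 𝕜 V) : Submodule 𝕜 V where
  carrier := {x | Tendsto (fun k : ℕ => (f ^ k) x) atTop (𝓝 0)}
  add_mem' {x y} hx hy := by
    simpa only [Set.mem_ofPred_eq, map_add, add_zero] using Tendsto.add hx hy
  zero_mem' := by simp only [Set.mem_ofPred_eq, map_zero, tendsto_const_nhds]
  smul_mem' c x hx := by
    simpa only [Set.mem_ofPred_eq, map_smul, smul_zero] using Tendsto.const_smul hx c

theorem mem_stableSubspace {f : Module.End 𝕜 V} {x : V} :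
    x ∈ stableSubspace f ↔ Tendsto (fun k : ℕ => (f ^ k) x) atTop (𝓝 0) :=
  Iff.rfl

theorem apply_mem_stableSubspace {f : Module.End 𝕜 V} {x : V} (hx : x ∈ stableSubspace f) :
    f x ∈ stableSubspace f :=
  (tendsto_add_atTop_iff_nat 1).2 (mem_stableSubspace.1 hx)

theorem norm_lt_one_of_hasEigenvector_of_mem_stableSubspace [CompleteSpace 𝕜] [T2Space V]
    {f : Module.End 𝕜 V} {μ : 𝕜} {x : V} (hx : f.HasEigenvector μ x)
    (hmem : x ∈ stableSubspace f) : ‖μ‖ < 1 := by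
  have hpow : Tendsto (fun k : ℕ => μ ^ k • x) atTop (𝓝 ((0 : 𝕜) • x)) := by
    simpa only [mem_stableSubspace, hx.pow_apply, zero_smul] using hmem
  exact tendsto_pow_atTop_nhds_zero_iff_norm_lt_one.1
    ((isClosedEmbedding_smul_left hx.2).tendsto_nhds_iff.2 hpow)

theorem tendsto_choose_mul_pow_sub_nhds_zero [CompleteSpace 𝕜] {μ : 𝕜} (hμ : ‖μ‖ < 1) (j : ℕ) :
    Tendsto (fun k : ℕ => μ ^ (k - j) * (k.choose j : 𝕜)) atTop (𝓝 0) := by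
  rw [← tendsto_add_atTop_iff_nat j]
  simpa only [Nat.add_sub_cancel, mul_comm] using
    (summable_choose_mul_geometric_of_norm_lt_one j hμ).tendsto_atTop_zero

theorem maxGenEigenspace_le_stableSubspace [CompleteSpace 𝕜] {f : Module.End 𝕜 V} {μ : 𝕜}
    (hμ : ‖μ‖ < 1) : f.maxGenEigenspace μ ≤ stableSubspace f := by
  intro x hx
  obtain ⟨d, hd⟩ := (Module.End.mem_maxGenEigenspace f μ x).1 hx
  set g := f - μ • (1 : Module.End 𝕜 V)
  have hvanish : ∀ j ≥ d, (g ^ j) x = 0 := fun j hj => by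
    rw [← Nat.sub_add_cancel hj, pow_add, Module.End.mul_apply, hd, map_zero]
  have hbinom : ∀ k : ℕ, (f ^ k) x =
      ∑ j ∈ Finset.range (k + 1), (μ ^ (k - j) * (k.choose j : 𝕜)) • (g ^ j) x := fun k => by
    have hcomm : Commute g (μ • 1) := (Commute.one_right g).smul_right μ
    rw [← sub_add_cancel f (μ • 1), hcomm.add_pow, LinearMap.sum_apply]
    refine Finset.sum_congr rfl fun j _ => ?_
    simp only [smul_pow, one_pow, Algebra.mul_smul_comm, mul_one, Algebra.smul_mul_assoc,
      LinearMap.smul_apply, Module.End.mul_apply, Module.End.natCast_apply,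
      ← Nat.cast_smul_eq_nsmul 𝕜, map_smul, mul_smul]
  have hlim : Tendsto (fun k : ℕ => ∑ j ∈ Finset.range d,
      (μ ^ (k - j) * (k.choose j : 𝕜)) • (g ^ j) x) atTop (𝓝 0) := by
    simpa only [zero_smul, Finset.sum_const_zero] using tendsto_finsetSum (Finset.range d)
      fun j _ => (tendsto_choose_mul_pow_sub_nhds_zero hμ j).smul_const ((g ^ j) x)
  refine hlim.congr' ((eventually_ge_atTop d).mono fun k hk => ?_)
  refine .trans ?_ (hbinom k).symm
  refine Finset.sum_subset (Finset.range_subset_range.2 (by omega)) fun j _ hj => ?_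
  rw [hvanish j (by simpa using hj), smul_zero]

theorem stableSubspace_eq_top [CompleteSpace 𝕜] [IsAlgClosed 𝕜] [FiniteDimensional 𝕜 V]
    {f : Module.End 𝕜 V} (hf : ∀ μ, f.HasEigenvalue μ → ‖μ‖ < 1) : stableSubspace f = ⊤ := by
  rw [eq_top_iff, ← Module.End.iSup_maxGenEigenspace_eq_top f]
  refine iSup_le fun μ => ?_
  rcases eq_or_ne (f.maxGenEigenspace μ) ⊥ with hbot | hne
  · exact hbot ▸ bot_le
  · exact maxGenEigenspace_le_stableSubspace
      (hf μ (Module.End.HasUnifEigenvalue.lt zero_lt_one hne))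

theorem exists_hasEigenvector_mem_of_mapsTo {K E : Type*} [Field K] [IsAlgClosed K]
    [AddCommGroup E] [Module K E] [FiniteDimensional K E] {f : Module.End K E} {W : Submodule K E}
    (hW : W ≠ ⊥) (hf : ∀ x ∈ W, f x ∈ W) : ∃ μ, ∃ x ∈ W, f.HasEigenvector μ x := by
  have : Nontrivial W := Submodule.nontrivial_iff_ne_bot.2 hW
  obtain ⟨μ, hμ⟩ := Module.End.exists_eigenvalue (f.restrict hf)
  obtain ⟨x, hx⟩ := hμ.exists_hasEigenvector
  refine ⟨μ, x, x.2, Module.End.mem_eigenspace_iff.2 ?_, fun h0 => hx.2 (Subtype.ext h0)⟩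
  exact congrArg Subtype.val hx.apply_eq_smul

theorem exists_common_hasEigenvector_of_commute {K E : Type*} [Field K] [IsAlgClosed K]
    [AddCommGroup E] [Module K E] [FiniteDimensional K E] {f g : Module.End K E}
    (h : Commute f g) {μ : K} (hμ : f.HasEigenvalue μ) :
    ∃ ν x, f.HasEigenvector μ x ∧ g.HasEigenvector ν x := by
  obtain ⟨ν, x, hx, hgx⟩ := exists_hasEigenvector_mem_of_mapsTo hμ
    (Module.End.mapsTo_genEigenspace_of_comm h μ 1)
  exact ⟨ν, x, ⟨hx, hgx.2⟩, hgx⟩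

theorem stableSubspace_eq_bot [CompleteSpace 𝕜] [IsAlgClosed 𝕜] [T2Space V]
    [FiniteDimensional 𝕜 V] {f : Module.End 𝕜 V} (hf : ∀ μ, f.HasEigenvalue μ → 1 ≤ ‖μ‖) :
    stableSubspace f = ⊥ := by
  by_contra hne
  obtain ⟨μ, x, hx, hμ⟩ :=
    exists_hasEigenvector_mem_of_mapsTo hne fun _ => apply_mem_stableSubspace
  exact (norm_lt_one_of_hasEigenvector_of_mem_stableSubspace hμ hx).not_ge
    (hf μ (Module.End.hasEigenvalue_of_hasEigenvector hμ))

theorem tendsto_zero_of_succ_eq_apply [CompleteSpace 𝕜] [IsAlgClosed 𝕜] [FiniteDimensional 𝕜 V]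
    {f : Module.End 𝕜 V} (hf : ∀ μ, f.HasEigenvalue μ → ‖μ‖ < 1) {x : ℕ → V}
    (hx : ∀ k, x (k + 1) = f (x k)) : Tendsto x atTop (𝓝 0) := by
  have hpow : ∀ k, (f ^ k) (x 0) = x k := fun k => by
    induction k with
    | zero => rfl
    | succ k ih => rw [pow_succ', Module.End.mul_apply, ih, hx]
  have hmem : x 0 ∈ stableSubspace f := stableSubspace_eq_top hf ▸ Submodule.mem_top
  exact (mem_stableSubspace.1 hmem).congr hpow

theorem hasEigenvalue_of_hasEigenvalue_cascade {K E W : Type*} [Field K] [AddCommGroup E]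
    [Module K E] [AddCommGroup W] [Module K W] {f : Module.End K E} {h : W →ₗ[K] E}
    {g : Module.End K W} {μ : K}
    (hμ : Module.End.HasEigenvalue ((f.coprod h).prod (g ∘ₗ LinearMap.snd K E W)) μ) :
    f.HasEigenvalue μ ∨ g.HasEigenvalue μ := by
  obtain ⟨⟨a, b⟩, hab⟩ := hμ.exists_hasEigenvector
  obtain ⟨ha, hb⟩ : f a + h b = μ • a ∧ g b = μ • b := Prod.ext_iff.1 hab.apply_eq_smul
  by_cases hb0 : b = 0
  · subst hb0
    have ha0 : a ≠ 0 := fun ha0 => hab.2 (Prod.ext ha0 rfl)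
    rw [map_zero, add_zero] at ha
    exact .inl (Module.End.hasEigenvalue_of_hasEigenvector
      ⟨Module.End.mem_eigenspace_iff.2 ha, ha0⟩)
  · exact .inr (Module.End.hasEigenvalue_of_hasEigenvector
      ⟨Module.End.mem_eigenspace_iff.2 hb, hb0⟩)

theorem tendsto_zero_of_cascade [CompleteSpace 𝕜] [IsAlgClosed 𝕜] [FiniteDimensional 𝕜 V]
    {W : Type*} [AddCommGroup W] [Module 𝕜 W] [TopologicalSpace W] [IsTopologicalAddGroup W]
    [ContinuousSMul 𝕜 W] [FiniteDimensional 𝕜 W] {f : Module.End 𝕜 V} {h : W →ₗ[𝕜] V}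
    {g : Module.End 𝕜 W} (hf : ∀ μ, f.HasEigenvalue μ → ‖μ‖ < 1)
    (hg : ∀ μ, g.HasEigenvalue μ → ‖μ‖ < 1) {x : ℕ → V} {y : ℕ → W}
    (hx : ∀ k, x (k + 1) = f (x k) + h (y k)) (hy : ∀ k, y (k + 1) = g (y k)) :
    Tendsto x atTop (𝓝 0) ∧ Tendsto y atTop (𝓝 0) := by
  have hxy : Tendsto (fun k => (x k, y k)) atTop (𝓝 0) :=
    tendsto_zero_of_succ_eq_apply
      (fun μ hμ => (hasEigenvalue_of_hasEigenvalue_cascade hμ).elim (hf μ) (hg μ))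
      fun k => Prod.ext (hx k) (hy k)
  exact ⟨(continuous_fst.tendsto 0).comp hxy, (continuous_snd.tendsto 0).comp hxy⟩

end StableSubspace

section Spectrum

theorem hasEigenvalue_toLin'_iff {K ι : Type*} [Field K] [Fintype ι] [DecidableEq ι]
    {A : Matrix ι ι K} {μ : K} :
    Module.End.HasEigenvalue (Matrix.toLin' A) μ ↔ μ ∈ spectrum K A := by
  rw [Module.End.hasEigenvalue_iff_mem_spectrum, Matrix.spectrum_toLin']

theorem exists_mulVec_eq_smul_of_mem_spectrum {K ι : Type*} [Field K] [Fintype ι] [DecidableEq ι]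
    {A : Matrix ι ι K} {μ : K} (hμ : μ ∈ spectrum K A) : ∃ w ≠ 0, A.mulVec w = μ • w := by
  obtain ⟨w, hw⟩ := (hasEigenvalue_toLin'_iff.2 hμ).exists_hasEigenvector
  exact ⟨w, hw.2, hw.apply_eq_smul⟩

theorem mem_spectrum_of_mul_eq_smul {R ι κ : Type*} [CommRing R] [Fintype ι] [DecidableEq ι]
    {A : Matrix ι ι R} {μ : R} {E : Matrix ι κ R} (hE : E ≠ 0) (h : A * E = μ • E) :
    μ ∈ spectrum R A := by
  refine spectrum.mem_iff.2 fun ⟨u, hu⟩ => hE ?_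
  have hzero : (u : Matrix ι ι R) * E = 0 := by
    rw [hu, Matrix.sub_mul, h, Algebra.algebraMap_eq_smul_one, Matrix.smul_mul, Matrix.one_mul,
      sub_self]
  rw [← Matrix.one_mul E, ← u.inv_mul, Matrix.mul_assoc, hzero, Matrix.mul_zero]

theorem mem_spectrum_of_mul_eq_smul_right {R ι κ : Type*} [CommRing R] [Fintype ι] [DecidableEq ι]
    {A : Matrix ι ι R} {μ : R} {E : Matrix κ ι R} (hE : E ≠ 0) (h : E * A = μ • E) :
    μ ∈ spectrum R A := by
  refine spectrum.mem_iff.2 fun ⟨u, hu⟩ => hE ?_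
  have hzero : E * (u : Matrix ι ι R) = 0 := by
    rw [hu, Matrix.mul_sub, h, Algebra.algebraMap_eq_smul_one, Matrix.mul_smul, Matrix.mul_one,
      sub_self]
  rw [← Matrix.mul_one E, ← u.mul_inv, ← Matrix.mul_assoc, hzero, Matrix.zero_mul]

theorem isSchurStable_smul {d : ℕ} {A : Matrix (Fin d) (Fin d) ℂ} {c : ℂ} (hc : ‖c‖ < 1)
    (hA : ∀ z ∈ spectrum ℂ A, ‖z‖ ≤ 1) : IsSchurStable (c • A) := by
  intro z hz
  rcases eq_or_ne c 0 with rfl | hc0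
  · obtain ⟨w, hw0, hw⟩ := exists_mulVec_eq_smul_of_mem_spectrum hz
    rw [zero_smul, Matrix.zero_mulVec, eq_comm, smul_eq_zero_iff_left hw0] at hw
    simp only [hw, norm_zero, zero_lt_one]
  · rw [← Units.smul_mk0 hc0, spectrum.unit_smul_eq_smul] at hz
    obtain ⟨ν, hν, rfl⟩ := hz
    calc ‖c * ν‖ = ‖c‖ * ‖ν‖ := norm_mul c ν
      _ ≤ ‖c‖ := mul_le_of_le_one_right (norm_nonneg c) (hA ν hν)
      _ < 1 := hc

theorem IsSchurStable.norm_trace_le {d : ℕ} {A : Matrix (Fin d) (Fin d) ℂ}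
    (hA : IsSchurStable A) : ‖A.trace‖ ≤ d := by
  have hroots : ∀ x ∈ A.charpoly.roots.map norm, x ≤ 1 := by
    intro x hx
    obtain ⟨z, hz, rfl⟩ := Multiset.mem_map.1 hx
    exact (hA z (Matrix.mem_spectrum_iff_isRoot_charpoly.2 (Polynomial.isRoot_of_mem_roots hz))).le
  calc ‖A.trace‖ = ‖A.charpoly.roots.sum‖ := by rw [Matrix.trace_eq_sum_roots_charpoly]
    _ ≤ (A.charpoly.roots.map norm).sum := norm_multiset_sum_le _
    _ ≤ (A.charpoly.roots.map norm).card • (1 : ℝ) := Multiset.sum_le_card_nsmul _ 1 hroots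
    _ ≤ d := by
      simpa only [Multiset.card_map, nsmul_one, Nat.cast_le, Matrix.charpoly_natDegree_eq_dim,
        Fintype.card_fin] using A.charpoly.card_roots'

/-- The error dynamics `Δ ↦ S Δ - F Δ cᵀ` of `N` identical systems `S` coupled by the gain `F` over
a network with coupling matrix `c`; the `j`-th column of `Δ` is the error of the `j`-th system. -/
def consensusMap {R ι κ : Type*} [CommRing R] [Fintype ι] [Fintype κ] (S F : Matrix ι ι R)
    (c : Matrix κ κ R) : Module.End R (Matrix ι κ R) :=
  mulLeftLinearMap κ R S -
    mulLeftLinearMap κ R F * mulRightLinearMap ι R c.transpose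

theorem consensusMap_apply {R ι κ : Type*} [CommRing R] [Fintype ι] [Fintype κ]
    (S F : Matrix ι ι R) (c : Matrix κ κ R) (Δ : Matrix ι κ R) :
    consensusMap S F c Δ = S * Δ - F * (Δ * c.transpose) :=
  rfl

theorem commute_consensusMap_mulRightLinearMap {R ι κ : Type*} [CommRing R] [Fintype ι]
    [Fintype κ] (S F : Matrix ι ι R) (c : Matrix κ κ R) :
    Commute (consensusMap S F c) (mulRightLinearMap ι R c.transpose) := by
  have hleft (B : Matrix ι ι R) :
      Commute (mulLeftLinearMap κ R B) (mulRightLinearMap ι R c.transpose) :=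
    commute_mulLeftLinearMap_mulRightLinearMap B c.transpose
  exact (hleft S).sub_left ((hleft F).mul_left (Commute.refl _))

/-- A joint eigenvector of the commuting maps `consensusMap S F c` and `Δ ↦ Δ cᵀ`, the latter with
eigenvalue `z`, is mapped by the former as by `S - z F`. -/
theorem exists_mem_spectrum_sub_smul_of_hasEigenvalue_consensusMap {K ι κ : Type*} [Field K]
    [IsAlgClosed K] [Fintype ι] [DecidableEq ι] [Fintype κ] [DecidableEq κ] {S F : Matrix ι ι K}
    {c : Matrix κ κ K} {ν : K} (hν : (consensusMap S F c).HasEigenvalue ν) :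
    ∃ z ∈ spectrum K c, ν ∈ spectrum K (S - z • F) := by
  obtain ⟨z, Δ, hΔν, hΔz⟩ :=
    exists_common_hasEigenvector_of_commute (commute_consensusMap_mulRightLinearMap S F c) hν
  have hright : Δ * c.transpose = z • Δ := hΔz.apply_eq_smul
  have hleft : S * Δ - F * (Δ * c.transpose) = ν • Δ := hΔν.apply_eq_smul
  refine ⟨z, mem_spectrum_of_mul_eq_smul (E := Δ.transpose) ?_ ?_,
    mem_spectrum_of_mul_eq_smul hΔν.2 ?_⟩
  · exact Matrix.transpose_eq_zero.not.2 hΔν.2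
  · rw [← Matrix.transpose_smul, ← hright, Matrix.transpose_mul, Matrix.transpose_transpose]
  · rw [Matrix.sub_mul, ← hleft, hright, Matrix.smul_mul, Matrix.mul_smul]

end Spectrum

section MatrixPowers

theorem isSchurStable_of_tendsto_pow {d : ℕ} {A : Matrix (Fin d) (Fin d) ℂ}
    (h : Tendsto (fun k : ℕ => A ^ k) atTop (𝓝 0)) : IsSchurStable A := by
  intro z hz
  obtain ⟨w, hw⟩ := (hasEigenvalue_toLin'_iff.2 hz).exists_hasEigenvector
  refine norm_lt_one_of_hasEigenvector_of_mem_stableSubspace hw (mem_stableSubspace.2 ?_)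
  have hcont : Continuous fun M : Matrix (Fin d) (Fin d) ℂ => M.mulVec w :=
    continuous_id.matrix_mulVec continuous_const
  simpa only [← Matrix.toLin'_pow, Matrix.toLin'_apply, Function.comp_def] using
    (hcont.tendsto' 0 0 (Matrix.zero_mulVec w)).comp h

theorem eq_zero_of_tendsto_mul_pow {𝕜 ι κ : Type*} [NontriviallyNormedField 𝕜] [CompleteSpace 𝕜]
    [IsAlgClosed 𝕜] [Fintype ι] [DecidableEq ι] [Finite κ] {A : Matrix ι ι 𝕜} {E : Matrix κ ι 𝕜}
    (hA : ∀ z ∈ spectrum 𝕜 A, 1 ≤ ‖z‖)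
    (h : Tendsto (fun k : ℕ => E * A ^ k) atTop (𝓝 0)) : E = 0 := by
  have hbot : stableSubspace (mulRightLinearMap κ 𝕜 A) = ⊥ := by
    refine stableSubspace_eq_bot fun μ hμ => ?_
    obtain ⟨G, hG⟩ := hμ.exists_hasEigenvector
    exact hA μ (mem_spectrum_of_mul_eq_smul_right hG.2 hG.apply_eq_smul)
  rw [← Submodule.mem_bot 𝕜, ← hbot, mem_stableSubspace]
  simpa only [pow_mulRightLinearMap, mulRightLinearMap_apply] using h

theorem tendsto_zero_of_forall_mulVec {R α ι κ : Type*} [NonAssocSemiring R] [TopologicalSpace R]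
    [Fintype κ] {l : Filter α} {M : α → Matrix ι κ R}
    (h : ∀ w, Tendsto (fun k => (M k).mulVec w) l (𝓝 0)) : Tendsto M l (𝓝 0) := by
  classical
  refine tendsto_pi_nhds.2 fun i => tendsto_pi_nhds.2 fun j => ?_
  simpa only [Matrix.mulVec_single_one, Matrix.col_apply, Pi.zero_apply, Matrix.zero_apply] using
    tendsto_pi_nhds.1 (h (Pi.single j 1)) i

theorem tendsto_mulVec_zero {R α ι κ : Type*} [NonUnitalNonAssocSemiring R] [TopologicalSpace R]
    [ContinuousAdd R] [ContinuousMul R] [Fintype κ] (M : Matrix ι κ R) {l : Filter α}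
    {x : α → κ → R} (hx : Tendsto x l (𝓝 0)) : Tendsto (fun k => M.mulVec (x k)) l (𝓝 0) :=
  ((continuous_const.matrix_mulVec continuous_id).tendsto' 0 0 (Matrix.mulVec_zero M)).comp hx

end MatrixPowers

section RealMatrices

theorem toComplex_mul {a b c : ℕ} (A : Matrix (Fin a) (Fin b) ℝ) (B : Matrix (Fin b) (Fin c) ℝ) :
    toComplex (A * B) = toComplex A * toComplex B :=
  Matrix.map_mul (f := Complex.ofRealHom)

theorem toComplex_pow {d : ℕ} (A : Matrix (Fin d) (Fin d) ℝ) (k : ℕ) :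
    toComplex (A ^ k) = toComplex A ^ k :=
  map_pow (Complex.ofRealHom.mapMatrix (m := Fin d)) A k

theorem toComplex_mulVec {a b : ℕ} (A : Matrix (Fin a) (Fin b) ℝ) (x : Fin b → ℝ) :
    (toComplex A).mulVec (Complex.ofReal ∘ x) = Complex.ofReal ∘ A.mulVec x :=
  funext fun i => (RingHom.map_mulVec Complex.ofRealHom A x i).symm

theorem toComplex_consensusMap {r N : ℕ} (S F : Matrix (Fin r) (Fin r) ℝ)
    (c : Matrix (Fin N) (Fin N) ℝ) (Δ : Matrix (Fin r) (Fin N) ℝ) :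
    toComplex (consensusMap S F c Δ) =
      consensusMap (toComplex S) (toComplex F) (toComplex c) (toComplex Δ) := by
  have hsub : toComplex (S * Δ - F * (Δ * c.transpose)) =
      toComplex (S * Δ) - toComplex (F * (Δ * c.transpose)) :=
    Matrix.map_sub _ Complex.ofReal_sub _ _
  simp only [consensusMap_apply, hsub, toComplex_mul]
  rfl

theorem isInducing_toComplex {a b : ℕ} : IsInducing (toComplex (a := a) (b := b)) :=
  Complex.isUniformEmbedding_ofReal.isEmbedding.isInducing.matrix_map

theorem tendsto_ofReal_comp_zero_iff {α ι : Type*} {l : Filter α} {x : α → ι → ℝ} :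
    Tendsto (fun k => Complex.ofReal ∘ x k) l (𝓝 0) ↔ Tendsto x l (𝓝 0) := by
  simp only [tendsto_pi_nhds, Function.comp_apply, Pi.zero_apply, ← tendsto_ofReal_iff,
    Complex.ofReal_zero]

theorem tendsto_toComplex_zero_iff {α : Type*} {l : Filter α} {a b : ℕ}
    {M : α → Matrix (Fin a) (Fin b) ℝ} :
    Tendsto (fun k => toComplex (M k)) l (𝓝 0) ↔ Tendsto M l (𝓝 0) := by
  rw [isInducing_toComplex.tendsto_nhds_iff]
  simp only [toComplex, Matrix.map_zero _ Complex.ofReal_zero, Function.comp_def]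

theorem isSchurStable_toComplex_of_tendsto_pow_mulVec {d : ℕ} {A : Matrix (Fin d) (Fin d) ℝ}
    (h : ∀ w, Tendsto (fun k : ℕ => (A ^ k).mulVec w) atTop (𝓝 0)) :
    IsSchurStable (toComplex A) := by
  refine isSchurStable_of_tendsto_pow ?_
  simpa only [toComplex_pow] using
    tendsto_toComplex_zero_iff.2 (tendsto_zero_of_forall_mulVec h)

theorem eq_zero_of_tendsto_mul_pow_mulVec {a d : ℕ} {A : Matrix (Fin d) (Fin d) ℝ}
    {E : Matrix (Fin a) (Fin d) ℝ} (hA : ∀ z ∈ spectrum ℂ (toComplex A), 1 ≤ ‖z‖)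
    (h : ∀ w, Tendsto (fun k : ℕ => (E * A ^ k).mulVec w) atTop (𝓝 0)) : E = 0 := by
  have hE : toComplex E = 0 := by
    refine eq_zero_of_tendsto_mul_pow hA ?_
    simpa only [toComplex_mul, toComplex_pow] using
      tendsto_toComplex_zero_iff.2 (tendsto_zero_of_forall_mulVec h)
  exact Matrix.map_injective Complex.ofReal_injective
    (hE.trans (Matrix.map_zero _ Complex.ofReal_zero).symm)

theorem tendsto_zero_of_consensus_cascade {a r N : ℕ} {A : Matrix (Fin a) (Fin a) ℝ}
    {E : Matrix (Fin a) (Fin r) ℝ} {S F : Matrix (Fin r) (Fin r) ℝ}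
    {c : Matrix (Fin N) (Fin N) ℝ} (hA : IsSchurStable (toComplex A))
    (hF : ∀ z ∈ spectrum ℂ (toComplex c), IsSchurStable (toComplex S - z • toComplex F))
    {b : Fin N → ℝ} {e : ℕ → Fin a → ℝ} {Δ : ℕ → Matrix (Fin r) (Fin N) ℝ}
    (he : ∀ k, e (k + 1) = A.mulVec (e k) + (E * Δ k).mulVec b)
    (hΔ : ∀ k, Δ (k + 1) = consensusMap S F c (Δ k)) :
    Tendsto e atTop (𝓝 0) ∧ Tendsto Δ atTop (𝓝 0) := by
  set f : Module.End ℂ (Fin a → ℂ) := Matrix.toLin' (toComplex A)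
  set g := consensusMap (toComplex S) (toComplex F) (toComplex c)
  set h := (Matrix.mulVecBilin ℂ ℂ).flip (Complex.ofReal ∘ b) ∘ₗ
    mulLeftLinearMap (Fin N) ℂ (toComplex E)
  have hf : ∀ μ, f.HasEigenvalue μ → ‖μ‖ < 1 := fun μ hμ => hA μ (hasEigenvalue_toLin'_iff.1 hμ)
  have hg : ∀ ν, g.HasEigenvalue ν → ‖ν‖ < 1 := fun ν hν => by
    obtain ⟨z, hz, hνz⟩ := exists_mem_spectrum_sub_smul_of_hasEigenvalue_consensusMap hν
    exact hF z hz ν hνz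
  have he' : ∀ k, Complex.ofReal ∘ e (k + 1) =
      f (Complex.ofReal ∘ e k) + h (toComplex (Δ k)) := fun k => by
    ext i
    simp only [f, h, he, Function.comp_apply, Pi.add_apply, Complex.ofReal_add,
      Matrix.toLin'_apply, toComplex_mulVec, LinearMap.coe_comp, mulLeftLinearMap_apply,
      ← toComplex_mul, LinearMap.flip_apply, Matrix.mulVecBilin_apply]
  have hΔ' : ∀ k, toComplex (Δ (k + 1)) = g (toComplex (Δ k)) := fun k => by
    rw [hΔ, toComplex_consensusMap]
  exact (tendsto_zero_of_cascade hf hg he' hΔ').imp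
    tendsto_ofReal_comp_zero_iff.1 tendsto_toComplex_zero_iff.1

end RealMatrices

section DataRigidity

/-- Perturbing `A` in the direction `W = t Zᵀ` shifts the trace of `A + W Z` by `t ‖Z‖²` (Frobenius
norm), while the trace of a stable matrix is bounded. -/
theorem eq_zero_of_forall_isSchurStable_add_mul {d q : ℕ} {A : Matrix (Fin d) (Fin d) ℝ}
    {Z : Matrix (Fin q) (Fin d) ℝ}
    (h : ∀ W : Matrix (Fin d) (Fin q) ℝ, IsSchurStable (toComplex (A + W * Z))) : Z = 0 := by
  have htrace : ∀ t : ℝ, |A.trace + t * (Z.transpose * Z).trace| ≤ d := fun t => by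
    have hle := (h (t • Z.transpose)).norm_trace_le
    have hmap : (toComplex (A + t • Z.transpose * Z)).trace =
        Complex.ofReal (A + t • Z.transpose * Z).trace :=
      (AddMonoidHom.map_trace Complex.ofRealHom _).symm
    rwa [hmap, Complex.norm_real, Matrix.trace_add, Matrix.smul_mul, Matrix.trace_smul,
      smul_eq_mul] at hle
  refine Matrix.trace_conjTranspose_mul_self_eq_zero_iff.1 ?_
  rw [Matrix.conjTranspose_eq_transpose_of_trivial]
  by_contra hne
  have hlarge := htrace ((d + 1 - A.trace) / (Z.transpose * Z).trace)
  rw [div_mul_cancel₀ _ hne, add_sub_cancel, abs_of_nonneg (by positivity)] at hlarge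
  linarith

theorem exists_mulVec_eq_of_forall_vecMul_eq_zero {K ι κ : Type*} [Field K] [Fintype ι]
    [Fintype κ] {A : Matrix ι κ K} {y : ι → K}
    (h : ∀ w : ι → K, Matrix.vecMul w A = 0 → w ⬝ᵥ y = 0) : ∃ x, A.mulVec x = y := by
  classical
  by_contra hy
  obtain ⟨f, hfy, hker⟩ := Submodule.exists_le_ker_of_notMem
    (p := LinearMap.range A.mulVecLin) (v := y) hy
  obtain ⟨w, rfl⟩ := (dotProductEquiv K ι).surjective f
  refine hfy (h w (dotProduct_eq_zero _ fun x => ?_))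
  rw [← Matrix.dotProduct_mulVec]
  exact hker (LinearMap.mem_range_self A.mulVecLin x)

theorem exists_mul_eq_of_forall_mul_eq_zero {K ι κ l q : Type*} [Field K] [Fintype ι]
    [Fintype κ] [Nonempty l] {A : Matrix ι κ K} {Y : Matrix ι q K}
    (h : ∀ W : Matrix l ι K, W * A = 0 → W * Y = 0) : ∃ M : Matrix κ q K, A * M = Y := by
  have hcol : ∀ j, ∃ x, A.mulVec x = Y.col j := fun j => by
    refine exists_mulVec_eq_of_forall_vecMul_eq_zero fun w hw => ?_
    have hrows := h (Matrix.of fun _ => w) (Matrix.ext fun _ k => congrFun hw k)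
    exact congrFun (congrFun hrows (Classical.arbitrary l)) j
  choose x hx using hcol
  exact ⟨Matrix.of fun k j => x j k, Matrix.ext fun i j => congrFun (hx j) i⟩

theorem exists_mul_eq_and_mul_eq_of_forall_add_eq_zero {K ι₁ ι₂ κ l q : Type*} [Field K]
    [Fintype ι₁] [Fintype ι₂] [Fintype κ] [Nonempty l] {X : Matrix ι₁ κ K} {U : Matrix ι₂ κ K}
    {Y : Matrix ι₁ q K} {Z : Matrix ι₂ q K}
    (h : ∀ (a : Matrix l ι₁ K) (b : Matrix l ι₂ K), a * X + b * U = 0 → a * Y + b * Z = 0) :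
    ∃ M : Matrix κ q K, X * M = Y ∧ U * M = Z := by
  have hrows : ∀ W : Matrix l (ι₁ ⊕ ι₂) K,
      W * Matrix.fromRows X U = 0 → W * Matrix.fromRows Y Z = 0 := fun W => by
    rw [← Matrix.fromCols_toCols W, Matrix.fromCols_mul_fromRows, Matrix.fromCols_mul_fromRows]
    exact h W.toCols₁ W.toCols₂
  obtain ⟨M, hM⟩ := exists_mul_eq_of_forall_mul_eq_zero hrows
  rw [Matrix.fromRows_mul] at hM
  exact ⟨M, Matrix.fromRows_inj hM⟩

end DataRigidity

section ExplainingSystems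

variable {d e r p q τ : ℕ} {U : Matrix (Fin e) (Fin τ) ℝ} {X : Matrix (Fin d) (Fin (τ + 1)) ℝ}
  {A : Matrix (Fin d) (Fin d) ℝ} {B : Matrix (Fin d) (Fin e) ℝ}

theorem mem_explainingSystems :
    (A, B) ∈ explainingSystems U X ↔ futureStates X = A * pastStates X + B * U :=
  Iff.rfl

theorem futureStates_mul (h : (A, B) ∈ explainingSystems U X) (M : Matrix (Fin τ) (Fin q) ℝ) :
    futureStates X * M = A * (pastStates X * M) + B * (U * M) := by
  rw [mem_explainingSystems.1 h, Matrix.add_mul, Matrix.mul_assoc, Matrix.mul_assoc]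

theorem add_mem_explainingSystems (h : (A, B) ∈ explainingSystems U X)
    {a : Matrix (Fin d) (Fin d) ℝ} {b : Matrix (Fin d) (Fin e) ℝ}
    (hab : a * pastStates X + b * U = 0) : (A + a, B + b) ∈ explainingSystems U X := by
  rw [mem_explainingSystems, mem_explainingSystems.1 h, Matrix.add_mul, Matrix.add_mul,
    add_add_add_comm, hab, add_zero]

theorem IsStabilizingRightInverse.isSchurStable {Xd : Matrix (Fin τ) (Fin d) ℝ}
    (hXd : IsStabilizingRightInverse X Xd) (h : (A, B) ∈ explainingSystems U X) :
    IsSchurStable (toComplex (A + B * (U * Xd))) := by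
  simpa only [futureStates_mul h, hXd.1, Matrix.mul_one] using hXd.2

theorem exists_isStabilizingRightInverse (hd : 0 < d) (h : (A, B) ∈ explainingSystems U X)
    {K : Matrix (Fin e) (Fin d) ℝ}
    (hK : ∀ A' B', (A', B') ∈ explainingSystems U X → IsSchurStable (toComplex (A' + B' * K))) :
    ∃ Xd, IsStabilizingRightInverse X Xd := by
  have : Nonempty (Fin d) := ⟨⟨0, hd⟩⟩
  have hann : ∀ (a : Matrix (Fin d) (Fin d) ℝ) (b : Matrix (Fin d) (Fin e) ℝ),
      a * pastStates X + b * U = 0 → a * 1 + b * K = 0 := fun a b hab => by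
    refine eq_zero_of_forall_isSchurStable_add_mul (A := A + B * K) fun W => ?_
    have hW : W * a * pastStates X + W * b * U = 0 := by
      rw [Matrix.mul_assoc, Matrix.mul_assoc, ← Matrix.mul_add, hab, Matrix.mul_zero]
    have hsplit : A + B * K + W * (a * 1 + b * K) = A + W * a + (B + W * b) * K := by
      rw [Matrix.mul_one, Matrix.mul_add, Matrix.add_mul, Matrix.mul_assoc, add_add_add_comm]
    exact hsplit ▸ hK _ _ (add_mem_explainingSystems h hW)
  obtain ⟨Xd, hX, hU⟩ := exists_mul_eq_and_mul_eq_of_forall_add_eq_zero hann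
  refine ⟨Xd, hX, ?_⟩
  rw [futureStates_mul h, hX, hU, Matrix.mul_one]
  exact hK A B h

variable {S : Matrix (Fin r) (Fin r) ℝ} {R : Matrix (Fin p) (Fin r) ℝ}
  {C : Matrix (Fin p) (Fin d) ℝ} {D : Matrix (Fin p) (Fin e) ℝ}

theorem SolvesDataRegulatorEquations.regulator_equation {M : Matrix (Fin τ) (Fin r) ℝ}
    (hM : SolvesDataRegulatorEquations S R C D U X M) (h : (A, B) ∈ explainingSystems U X) :
    A * (pastStates X * M) + B * (U * M) = pastStates X * M * S := by
  rw [← futureStates_mul h, sub_eq_zero.1 hM.1]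

theorem SolvesDataRegulatorEquations.output_equation {M : Matrix (Fin τ) (Fin r) ℝ}
    (hM : SolvesDataRegulatorEquations S R C D U X M) :
    C * (pastStates X * M) + D * (U * M) = R := by
  rw [← Matrix.mul_assoc, ← Matrix.mul_assoc, hM.2]

theorem exists_solvesDataRegulatorEquations (hd : 0 < d) (h : (A, B) ∈ explainingSystems U X)
    {Pi : Matrix (Fin d) (Fin r) ℝ} {Gam : Matrix (Fin e) (Fin r) ℝ}
    (hreg : ∀ A' B', (A', B') ∈ explainingSystems U X → A' * Pi + B' * Gam = Pi * S)
    (hout : C * Pi + D * Gam = R) : ∃ M, SolvesDataRegulatorEquations S R C D U X M := by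
  have : Nonempty (Fin d) := ⟨⟨0, hd⟩⟩
  have hann : ∀ (a : Matrix (Fin d) (Fin d) ℝ) (b : Matrix (Fin d) (Fin e) ℝ),
      a * pastStates X + b * U = 0 → a * Pi + b * Gam = 0 := fun a b hab => by
    have hperturbed := hreg _ _ (add_mem_explainingSystems h hab)
    rwa [← hreg A B h, Matrix.add_mul, Matrix.add_mul, add_add_add_comm, add_eq_left]
      at hperturbed
  obtain ⟨M, hX, hU⟩ := exists_mul_eq_and_mul_eq_of_forall_add_eq_zero hann
  refine ⟨M, ?_, ?_⟩
  · rw [futureStates_mul h, hX, hU, hreg A B h, sub_self]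
  · rw [Matrix.mul_assoc, Matrix.mul_assoc, hX, hU, hout]

end ExplainingSystems

section Substochastic

theorem sum_eq_one_and_eq_of_le_sum_mul {ι : Type*} [Fintype ι] {q f : ι → ℝ} {M : ℝ}
    (hM : 0 < M) (hq : ∀ j, 0 ≤ q j) (hsum : ∑ j, q j ≤ 1) (hf : ∀ j, f j ≤ M)
    (h : M ≤ ∑ j, q j * f j) : ∑ j, q j = 1 ∧ ∀ j, q j ≠ 0 → f j = M := by
  have hdefect : ∑ j, q j * (M - f j) = (∑ j, q j) * M - ∑ j, q j * f j := by
    simp only [mul_sub, Finset.sum_sub_distrib, Finset.sum_mul]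
  have hterm : ∀ j ∈ Finset.univ, 0 ≤ q j * (M - f j) := fun j _ =>
    mul_nonneg (hq j) (sub_nonneg.2 (hf j))
  have hnonneg : 0 ≤ ∑ j, q j * (M - f j) := Finset.sum_nonneg hterm
  have hone : ∑ j, q j = 1 := le_antisymm hsum (le_of_mul_le_mul_right (by linarith) hM)
  refine ⟨hone, fun j hj => ?_⟩
  have hzero : ∑ j, q j * (M - f j) = 0 := by
    rw [hone, one_mul] at hdefect
    linarith
  have hjzero := (Finset.sum_eq_zero_iff_of_nonneg hterm).1 hzero j (Finset.mem_univ j)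
  exact (sub_eq_zero.1 ((mul_eq_zero.1 hjzero).resolve_left hj)).symm

theorem norm_lt_one_of_mem_spectrum_of_substochastic {ι : Type*} [Fintype ι] [DecidableEq ι]
    {Q : Matrix ι ι ℝ} (hQ : ∀ i j, 0 ≤ Q i j) (hsum : ∀ i, ∑ j, Q i j ≤ 1)
    (hreach : ∀ i, ∃ j, ∑ l, Q j l < 1 ∧ Relation.ReflTransGen (fun a b => Q a b ≠ 0) i j)
    {z : ℂ} (hz : z ∈ spectrum ℂ (Q.map Complex.ofReal)) : ‖z‖ < 1 := by
  obtain ⟨w, hw0, hw⟩ := exists_mulVec_eq_smul_of_mem_spectrum hz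
  by_contra! hz1
  obtain ⟨i, hi⟩ := Function.ne_iff.1 hw0
  obtain ⟨i₀, hi₀⟩ := @Finite.exists_max _ _ _ ⟨i⟩ _ fun i => ‖w i‖
  have hpos : 0 < ‖w i₀‖ := (norm_pos_iff.2 hi).trans_le (hi₀ i)
  have hmax : ∀ i, ‖w i‖ = ‖w i₀‖ →
      ∑ j, Q i j = 1 ∧ ∀ j, Q i j ≠ 0 → ‖w j‖ = ‖w i₀‖ := fun i hi =>
    sum_eq_one_and_eq_of_le_sum_mul hpos (hQ i) (hsum i) hi₀ <| calc
      ‖w i₀‖ ≤ ‖z‖ * ‖w i‖ := hi ▸ le_mul_of_one_le_left (norm_nonneg _) hz1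
      _ = ‖∑ j, (Q i j : ℂ) * w j‖ := by
        rw [← norm_mul]
        exact congrArg norm (congrFun hw i).symm
      _ ≤ ∑ j, ‖(Q i j : ℂ) * w j‖ := norm_sum_le _ _
      _ = ∑ j, Q i j * ‖w j‖ := by
        simp only [norm_mul, Complex.norm_real, Real.norm_of_nonneg (hQ i _)]
  have hconst : ∀ j, Relation.ReflTransGen (fun a b => Q a b ≠ 0) i₀ j → ‖w j‖ = ‖w i₀‖ :=
    fun j hpath => by
      induction hpath with
      | refl => rfl
      | tail _ hab ih => exact (hmax _ ih).2 _ hab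
  obtain ⟨j, hj, hpath⟩ := hreach i₀
  exact hj.ne (hmax j (hconst j hpath)).1

end Substochastic

theorem WeightedDigraph.degree_nonneg {N : ℕ} (G : WeightedDigraph N) (i : Fin N) :
    0 ≤ G.degree i :=
  Finset.sum_nonneg fun j _ => G.adj_nonneg i j

namespace LeaderFollowerNetwork

variable {N r p : ℕ} {n m : Fin N → ℕ}

section Coupling

variable (net : LeaderFollowerNetwork N r p n m)

/-- Every follower is reached by a directed path from some follower to which the leader sends its
state; equivalently, the leader is a root of the graph obtained by adding it as a node. -/
def LeaderReachesAll : Prop :=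
  ∀ i, ∃ j, 0 < net.g j ∧ Relation.ReflTransGen net.graph.Edge j i

variable {net} in
theorem CommunicationAssumption.leaderReachesAll (h : net.CommunicationAssumption) :
    net.LeaderReachesAll := by
  obtain ⟨-, T, root, hT, hroot⟩ := h
  exact fun i => ⟨root, hroot, Relation.ReflTransGen.mono hT.edge _ _ (hT.reachable i)⟩

theorem one_add_degree_add_pos (i : Fin N) : 0 < 1 + net.graph.degree i + net.g i :=
  add_pos_of_pos_of_nonneg (add_pos_of_pos_of_nonneg one_pos (net.graph.degree_nonneg i))
    (net.g_nonneg i)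

theorem couplingMatrix_eq :
    net.couplingMatrix =
      1 - Matrix.diagonal (fun i => (1 + net.graph.degree i + net.g i)⁻¹) *
        (1 + net.graph.adj) := by
  have hinv : Matrix.diagonal (fun i => (1 + net.graph.degree i + net.g i)⁻¹) *
      (1 + net.graph.degreeMatrix + Matrix.diagonal net.g) = 1 := by
    rw [WeightedDigraph.degreeMatrix, ← Matrix.diagonal_one, Matrix.diagonal_add,
      Matrix.diagonal_add, Matrix.diagonal_mul_diagonal]
    exact congrArg _ (funext fun i => inv_mul_cancel₀ (net.one_add_degree_add_pos i).ne')
  have hsplit : net.graph.laplacian + Matrix.diagonal net.g =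
      1 + net.graph.degreeMatrix + Matrix.diagonal net.g - (1 + net.graph.adj) := by
    rw [WeightedDigraph.laplacian]
    abel
  rw [couplingMatrix, Matrix.inv_eq_left_inv hinv, hsplit, Matrix.mul_sub, hinv]

theorem couplingMatrix_apply (i j : Fin N) :
    net.couplingMatrix i j = (1 : Matrix (Fin N) (Fin N) ℝ) i j -
      (1 + net.graph.degree i + net.g i)⁻¹ *
        ((1 : Matrix (Fin N) (Fin N) ℝ) i j + net.graph.adj i j) := by
  rw [couplingMatrix_eq, Matrix.sub_apply, Matrix.diagonal_mul, Matrix.add_apply]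

theorem one_sub_couplingMatrix_apply (i j : Fin N) :
    (1 - net.couplingMatrix) i j =
      (1 + net.graph.degree i + net.g i)⁻¹ *
        ((1 : Matrix (Fin N) (Fin N) ℝ) i j + net.graph.adj i j) := by
  rw [Matrix.sub_apply, couplingMatrix_apply, sub_sub_cancel]

theorem sum_one_sub_couplingMatrix (i : Fin N) :
    ∑ j, (1 - net.couplingMatrix) i j =
      (1 + net.graph.degree i) / (1 + net.graph.degree i + net.g i) := by
  simp only [one_sub_couplingMatrix_apply, ← Finset.mul_sum, Finset.sum_add_distrib,
    Matrix.one_apply, Finset.sum_ite_eq, Finset.mem_univ, if_true]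
  exact inv_mul_eq_div _ _

theorem one_sub_couplingMatrix_nonneg (i j : Fin N) : 0 ≤ (1 - net.couplingMatrix) i j := by
  rw [one_sub_couplingMatrix_apply]
  exact mul_nonneg (inv_nonneg.2 (net.one_add_degree_add_pos i).le)
    (add_nonneg (Matrix.zero_le_one_elem i j) (net.graph.adj_nonneg i j))

theorem one_sub_couplingMatrix_ne_zero {i j : Fin N} (h : net.graph.Edge j i) :
    (1 - net.couplingMatrix) i j ≠ 0 := by
  have hadj : 0 < net.graph.adj i j := lt_of_le_of_ne (net.graph.adj_nonneg i j) (Ne.symm h)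
  rw [one_sub_couplingMatrix_apply]
  exact mul_ne_zero (inv_ne_zero (net.one_add_degree_add_pos i).ne')
    (add_pos_of_nonneg_of_pos (Matrix.zero_le_one_elem i j) hadj).ne'

variable {net}

theorem LeaderReachesAll.norm_one_sub_lt_one_of_mem_spectrum (h : net.LeaderReachesAll) {z : ℂ}
    (hz : z ∈ spectrum ℂ (toComplex net.couplingMatrix)) : ‖1 - z‖ < 1 := by
  have hmap : (1 - net.couplingMatrix).map Complex.ofReal = 1 - toComplex net.couplingMatrix := by
    rw [Matrix.map_sub _ Complex.ofReal_sub, Matrix.map_one _ Complex.ofReal_zero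
      Complex.ofReal_one]
    rfl
  have hz' : 1 - z ∈ spectrum ℂ ((1 - net.couplingMatrix).map Complex.ofReal) := by
    rw [hmap, ← map_one (algebraMap ℂ (Matrix (Fin N) (Fin N) ℂ)), ← spectrum.singleton_sub_eq]
    exact Set.sub_mem_sub rfl hz
  refine norm_lt_one_of_mem_spectrum_of_substochastic net.one_sub_couplingMatrix_nonneg
    (fun i => ?_) (fun i => ?_) hz'
  · rw [sum_one_sub_couplingMatrix, div_le_one (net.one_add_degree_add_pos i)]
    exact le_add_of_nonneg_right (net.g_nonneg i)
  · obtain ⟨j, hj, hpath⟩ := h i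
    refine ⟨j, ?_, Relation.ReflTransGen.mono (fun a b hab =>
      net.one_sub_couplingMatrix_ne_zero hab) _ _ (Relation.reflTransGen_swap.2 hpath)⟩
    rw [sum_one_sub_couplingMatrix, div_lt_one (net.one_add_degree_add_pos j)]
    exact lt_add_of_pos_right _ hj

theorem LeaderReachesAll.isStabilizingGain_self (h : net.LeaderReachesAll)
    (hS : ∀ z ∈ spectrum ℂ (toComplex net.S), ‖z‖ ≤ 1) : net.IsStabilizingGain net.S :=
  fun z hz => by
    have hsmul : toComplex net.S - z • toComplex net.S = (1 - z) • toComplex net.S := by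
      rw [sub_smul, one_smul]
    exact hsmul ▸ isSchurStable_smul (h.norm_one_sub_lt_one_of_mem_spectrum hz) hS

end Coupling

section Trajectories

/-- The observer errors `v_j(k) - x_r(k)` at time `k`, as the columns of a matrix. -/
def observerError (xr : ℕ → Fin r → ℝ) (v : Fin N → ℕ → Fin r → ℝ) (k : ℕ) :
    Matrix (Fin r) (Fin N) ℝ :=
  (Matrix.of fun j => v j k - xr k).transpose

theorem observerError_mulVec (xr : ℕ → Fin r → ℝ) (v : Fin N → ℕ → Fin r → ℝ) (k : ℕ)
    (b : Fin N → ℝ) : (observerError xr v k).mulVec b = ∑ j, b j • (v j k - xr k) := by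
  rw [observerError, Matrix.mulVec_transpose, Matrix.vecMul_eq_sum]
  rfl

theorem observerError_const (xr : ℕ → Fin r → ℝ) (k : ℕ) :
    observerError xr (fun _ : Fin N => xr) k = 0 := by
  simp only [observerError, sub_self]
  rfl

theorem sum_couplingMatrix_smul_sub (net : LeaderFollowerNetwork N r p n m) (i : Fin N)
    (xr : Fin r → ℝ) (v : Fin N → Fin r → ℝ) :
    ∑ j, net.couplingMatrix i j • (v j - xr) =
      -((1 + net.graph.degree i + net.g i)⁻¹ •
        ((∑ j, net.graph.adj i j • (v j - v i)) + net.g i • (xr - v i))) := by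
  have hsum (y : Fin r → ℝ) : ∑ j, net.graph.adj i j • (v j - y) =
      ∑ j, net.graph.adj i j • v j - net.graph.degree i • y := by
    simp only [smul_sub, Finset.sum_sub_distrib, WeightedDigraph.degree, Finset.sum_smul]
  have hexpand : ∑ j, net.couplingMatrix i j • (v j - xr) = (v i - xr) -
      (1 + net.graph.degree i + net.g i)⁻¹ •
        ((v i - xr) + ∑ j, net.graph.adj i j • (v j - xr)) := by
    simp only [couplingMatrix_apply, Matrix.one_apply, sub_smul, mul_smul, add_smul,
      ite_smul, one_smul, zero_smul, Finset.sum_sub_distrib, Finset.sum_add_distrib,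
      ← Finset.smul_sum, Finset.sum_ite_eq, Finset.mem_univ, if_true]
  have hw := (net.one_add_degree_add_pos i).ne'
  rw [hexpand, hsum, hsum]
  match_scalars <;> field_simp <;> ring

variable {net : LeaderFollowerNetwork N r p n m} {P : Protocol N r n m}
  {A : ∀ i, Matrix (Fin (n i)) (Fin (n i)) ℝ} {B : ∀ i, Matrix (Fin (n i)) (Fin (m i)) ℝ}
  {xr : ℕ → Fin r → ℝ} {x : ∀ i, ℕ → Fin (n i) → ℝ} {u : ∀ i, ℕ → Fin (m i) → ℝ}
  {v : Fin N → ℕ → Fin r → ℝ}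

theorem IsTrajectory.controller_eq (h : net.IsTrajectory P A B xr x u v) (i : Fin N) (k : ℕ) :
    v i (k + 1) = net.S.mulVec (v i k) -
      P.F.mulVec ((observerError xr v k).mulVec (net.couplingMatrix i)) := by
  rw [h.controller, observerError_mulVec, net.sum_couplingMatrix_smul_sub i (xr k) fun j => v j k,
    Matrix.mulVec_neg, Matrix.mulVec_smul, sub_neg_eq_add]

theorem IsTrajectory.observerError_succ (h : net.IsTrajectory P A B xr x u v) (k : ℕ) :
    observerError xr v (k + 1) =
      consensusMap net.S P.F net.couplingMatrix (observerError xr v k) := by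
  have hcol (j : Fin N) : v j (k + 1) - xr (k + 1) = net.S.mulVec (v j k - xr k) -
      P.F.mulVec ((observerError xr v k).mulVec (net.couplingMatrix j)) := by
    rw [h.controller_eq, h.leader, sub_right_comm, Matrix.mulVec_sub]
  ext a j
  exact congrFun (hcol j) a

theorem IsTrajectory.regulationError_succ (h : net.IsTrajectory P A B xr x u v) (i : Fin N)
    (k : ℕ) :
    x i (k + 1) - (P.Pi i).mulVec (v i (k + 1)) =
      (A i + B i * P.K i).mulVec (x i k - (P.Pi i).mulVec (v i k)) +
        (A i * P.Pi i + B i * P.Gam i - P.Pi i * net.S).mulVec (v i k) +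
        (P.Pi i * P.F * observerError xr v k).mulVec (net.couplingMatrix i) := by
  rw [h.follower, h.controller_eq, h.input]
  simp only [Matrix.mulVec_add, Matrix.add_mulVec, Matrix.sub_mulVec, Matrix.mulVec_sub,
    ← Matrix.mulVec_mulVec]
  abel

theorem IsTrajectory.outputError_eq (h : net.IsTrajectory P A B xr x u v) (i : Fin N) (k : ℕ) :
    (net.C i).mulVec (x i k) + (net.D i).mulVec (u i k) - net.R.mulVec (xr k) =
      (net.C i + net.D i * P.K i).mulVec (x i k - (P.Pi i).mulVec (v i k)) +
        (net.C i * P.Pi i + net.D i * P.Gam i - net.R).mulVec (v i k) +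
        net.R.mulVec (v i k - xr k) := by
  rw [h.input]
  simp only [Matrix.mulVec_add, Matrix.add_mulVec, Matrix.sub_mulVec, Matrix.mulVec_sub,
    ← Matrix.mulVec_mulVec]
  abel

theorem achievesOutputSync_of_regulator_equations (hF : net.IsStabilizingGain P.F)
    (hK : ∀ i, IsSchurStable (toComplex (A i + B i * P.K i)))
    (hreg : ∀ i, A i * P.Pi i + B i * P.Gam i = P.Pi i * net.S)
    (hout : ∀ i, net.C i * P.Pi i + net.D i * P.Gam i = net.R) :
    net.AchievesOutputSync P A B := by
  intro xr x u v h i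
  obtain ⟨hregulation, hobserver⟩ := tendsto_zero_of_consensus_cascade (hK i) hF
    (e := fun k => x i k - (P.Pi i).mulVec (v i k)) (E := P.Pi i * P.F)
    (b := net.couplingMatrix i)
    (fun k => by
      rw [h.regulationError_succ, hreg, sub_self, Matrix.zero_mulVec, add_zero])
    h.observerError_succ
  have hcol : Continuous fun Δ : Matrix (Fin r) (Fin N) ℝ => Δ.transpose i :=
    (continuous_apply i).comp continuous_id.matrix_transpose
  have hv : Tendsto (fun k => v i k - xr k) atTop (𝓝 0) := (hcol.tendsto 0).comp hobserver
  refine ⟨?_, hv, hregulation⟩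
  have hy := (tendsto_mulVec_zero (net.C i + net.D i * P.K i) hregulation).add
    (tendsto_mulVec_zero net.R hv)
  rw [add_zero] at hy
  refine hy.congr fun k => ?_
  rw [h.outputError_eq, hout, sub_self, Matrix.zero_mulVec, add_zero]

theorem exists_isTrajectory_of_leader (net : LeaderFollowerNetwork N r p n m)
    (P : Protocol N r n m) (A : ∀ i, Matrix (Fin (n i)) (Fin (n i)) ℝ)
    (B : ∀ i, Matrix (Fin (n i)) (Fin (m i)) ℝ) (w : Fin r → ℝ) (x₀ : ∀ i, Fin (n i) → ℝ) :
    ∃ x u, net.IsTrajectory P A B (fun k => (net.S ^ k).mulVec w) x u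
      (fun _ k => (net.S ^ k).mulVec w) ∧ ∀ i, x i 0 = x₀ i := by
  let input : ∀ i, ℕ → (Fin (n i) → ℝ) → Fin (m i) → ℝ := fun i k y =>
    (P.K i).mulVec (y - (P.Pi i).mulVec ((net.S ^ k).mulVec w)) +
      (P.Gam i).mulVec ((net.S ^ k).mulVec w)
  let x : ∀ i, ℕ → Fin (n i) → ℝ := fun i k =>
    Nat.rec (x₀ i) (fun k y => (A i).mulVec y + (B i).mulVec (input i k y)) k
  have hleader (k : ℕ) : (net.S ^ (k + 1)).mulVec w = net.S.mulVec ((net.S ^ k).mulVec w) := by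
    rw [pow_succ', Matrix.mulVec_mulVec]
  refine ⟨x, fun i k => input i k (x i k), ⟨hleader, fun i k => rfl, fun i k => ?_,
    fun i k => rfl⟩, fun i => rfl⟩
  simp only [hleader, sub_self, smul_zero, Finset.sum_const_zero, add_zero, Matrix.mulVec_zero]

theorem AchievesOutputSync.isSchurStable (h : net.AchievesOutputSync P A B) (i : Fin N) :
    IsSchurStable (toComplex (A i + B i * P.K i)) := by
  refine isSchurStable_toComplex_of_tendsto_pow_mulVec fun y => ?_
  obtain ⟨x, u, htraj, hx₀⟩ := net.exists_isTrajectory_of_leader P A B 0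
    (Function.update (fun _ => 0) i y)
  refine (h _ _ _ _ htraj i).2.2.congr fun k => ?_
  induction k with
  | zero => simp only [hx₀, Function.update_self, Matrix.mulVec_zero, sub_zero, pow_zero,
      Matrix.one_mulVec]
  | succ k ih =>
    rw [htraj.regulationError_succ, ih, observerError_const, pow_succ']
    simp only [Matrix.mulVec_zero, Matrix.mul_zero, Matrix.zero_mulVec, add_zero,
      Matrix.mulVec_mulVec]

theorem AchievesOutputSync.regulator_equation (h : net.AchievesOutputSync P A B)
    (hS : ∀ z ∈ spectrum ℂ (toComplex net.S), 1 ≤ ‖z‖) (i : Fin N) :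
    A i * P.Pi i + B i * P.Gam i = P.Pi i * net.S := by
  refine sub_eq_zero.1 (eq_zero_of_tendsto_mul_pow_mulVec hS fun w => ?_)
  obtain ⟨x, u, htraj, -⟩ := net.exists_isTrajectory_of_leader P A B w 0
  have hregulation := (h _ _ _ _ htraj i).2.2
  have hlim := ((tendsto_add_atTop_iff_nat 1).2 hregulation).sub
    (tendsto_mulVec_zero (A i + B i * P.K i) hregulation)
  rw [sub_zero] at hlim
  refine hlim.congr fun k => ?_
  rw [htraj.regulationError_succ, observerError_const, Matrix.mul_zero, Matrix.zero_mulVec,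
    add_zero, add_sub_cancel_left, Matrix.mulVec_mulVec]

theorem AchievesOutputSync.output_equation (h : net.AchievesOutputSync P A B)
    (hS : ∀ z ∈ spectrum ℂ (toComplex net.S), 1 ≤ ‖z‖) (i : Fin N) :
    net.C i * P.Pi i + net.D i * P.Gam i = net.R := by
  refine sub_eq_zero.1 (eq_zero_of_tendsto_mul_pow_mulVec hS fun w => ?_)
  obtain ⟨x, u, htraj, -⟩ := net.exists_isTrajectory_of_leader P A B w 0
  obtain ⟨houtput, -, hregulation⟩ := h _ _ _ _ htraj i
  have hlim := houtput.sub (tendsto_mulVec_zero (net.C i + net.D i * P.K i) hregulation)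
  rw [sub_zero] at hlim
  refine hlim.congr fun k => ?_
  rw [htraj.outputError_eq, sub_self, Matrix.mulVec_zero, add_zero, add_sub_cancel_left,
    Matrix.mulVec_mulVec]

end Trajectories

section Data

variable {net : LeaderFollowerNetwork N r p n m} {P : Protocol N r n m} {τ : ℕ}
  {U : ∀ i, Matrix (Fin (m i)) (Fin τ) ℝ} {X : ∀ i, Matrix (Fin (n i)) (Fin (τ + 1)) ℝ}
  {A : ∀ i, Matrix (Fin (n i)) (Fin (n i)) ℝ} {B : ∀ i, Matrix (Fin (n i)) (Fin (m i)) ℝ}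

theorem AchievesOutputSyncForData.achievesOutputSync_update
    (h : net.AchievesOutputSyncForData U X P)
    (hdata : ∀ i, (A i, B i) ∈ explainingSystems (U i) (X i)) {i : Fin N}
    {A' : Matrix (Fin (n i)) (Fin (n i)) ℝ} {B' : Matrix (Fin (n i)) (Fin (m i)) ℝ}
    (hAB : (A', B') ∈ explainingSystems (U i) (X i)) :
    net.AchievesOutputSync P (Function.update A i A') (Function.update B i B') := by
  refine h _ _ fun j => ?_
  rcases eq_or_ne j i with rfl | hj
  · simpa only [Function.update_self] using hAB
  · simpa only [Function.update_of_ne hj] using hdata j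

theorem AchievesOutputSyncForData.exists_isStabilizingRightInverse (hn : ∀ i, 0 < n i)
    (h : net.AchievesOutputSyncForData U X P)
    (hdata : ∀ i, (A i, B i) ∈ explainingSystems (U i) (X i)) (i : Fin N) :
    ∃ Xd, IsStabilizingRightInverse (X i) Xd :=
  _root_.exists_isStabilizingRightInverse (hn i) (hdata i) fun A' B' hAB => by
    simpa only [Function.update_self] using
      (h.achievesOutputSync_update hdata hAB).isSchurStable i

theorem AchievesOutputSyncForData.exists_solvesDataRegulatorEquations (hn : ∀ i, 0 < n i)
    (hS : ∀ z ∈ spectrum ℂ (toComplex net.S), 1 ≤ ‖z‖) (h : net.AchievesOutputSyncForData U X P)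
    (hdata : ∀ i, (A i, B i) ∈ explainingSystems (U i) (X i)) (i : Fin N) :
    ∃ M, SolvesDataRegulatorEquations net.S net.R (net.C i) (net.D i) (U i) (X i) M :=
  _root_.exists_solvesDataRegulatorEquations (hn i) (hdata i)
    (fun A' B' hAB => by
      simpa only [Function.update_self] using
        (h.achievesOutputSync_update hdata hAB).regulator_equation hS i)
    ((h A B hdata).output_equation hS i)

theorem IsStabilizingGain.achievesOutputSyncForData {F : Matrix (Fin r) (Fin r) ℝ}
    {Xd : ∀ i, Matrix (Fin τ) (Fin (n i)) ℝ} {M : ∀ _ : Fin N, Matrix (Fin τ) (Fin r) ℝ}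
    (hF : net.IsStabilizingGain F) (hXd : ∀ i, IsStabilizingRightInverse (X i) (Xd i))
    (hM : ∀ i,
      SolvesDataRegulatorEquations net.S net.R (net.C i) (net.D i) (U i) (X i) (M i)) :
    net.AchievesOutputSyncForData U X
      { F := F
        K := fun i => U i * Xd i
        Pi := fun i => pastStates (X i) * M i
        Gam := fun i => U i * M i } :=
  fun _ _ hAB => achievesOutputSync_of_regulator_equations hF
    (fun i => (hXd i).isSchurStable (hAB i)) (fun i => (hM i).regulator_equation (hAB i))
    fun i => (hM i).output_equation

end Data

end LeaderFollowerNetwork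

theorem proposition3_general {N r p τ : ℕ} {n m : Fin N → ℕ} (hn : ∀ i, 0 < n i)
    (net : LeaderFollowerNetwork N r p n m)
    (hS : ∀ z ∈ spectrum ℂ (toComplex net.S), ‖z‖ = 1) (hG : net.LeaderReachesAll)
    (U : ∀ i, Matrix (Fin (m i)) (Fin τ) ℝ)
    (X : ∀ i, Matrix (Fin (n i)) (Fin (τ + 1)) ℝ)
    (Abar : ∀ i, Matrix (Fin (n i)) (Fin (n i)) ℝ)
    (Bbar : ∀ i, Matrix (Fin (n i)) (Fin (m i)) ℝ)
    (hdata : ∀ i, (Abar i, Bbar i) ∈ explainingSystems (U i) (X i)) :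
    (net.InformativeForOutputSync U X ↔
      ∀ i, (∃ Xd, IsStabilizingRightInverse (X i) Xd) ∧
        ∃ M, SolvesDataRegulatorEquations net.S net.R (net.C i) (net.D i) (U i) (X i) M) ∧
    (∃ F, net.IsStabilizingGain F) ∧
    (∀ (F : Matrix (Fin r) (Fin r) ℝ) (Xd : ∀ i, Matrix (Fin τ) (Fin (n i)) ℝ)
        (M : ∀ _ : Fin N, Matrix (Fin τ) (Fin r) ℝ),
      net.IsStabilizingGain F →
      (∀ i, IsStabilizingRightInverse (X i) (Xd i)) →
      (∀ i, SolvesDataRegulatorEquations net.S net.R (net.C i) (net.D i) (U i) (X i) (M i)) →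
      net.AchievesOutputSyncForData U X
        { F := F
          K := fun i => U i * Xd i
          Pi := fun i => pastStates (X i) * M i
          Gam := fun i => U i * M i }) := by
  have hgain : net.IsStabilizingGain net.S :=
    hG.isStabilizingGain_self fun z hz => (hS z hz).le
  refine ⟨⟨?_, fun h => ?_⟩, ⟨net.S, hgain⟩, fun F Xd M hF hXd hM =>
    hF.achievesOutputSyncForData hXd hM⟩
  · rintro ⟨P, hP⟩ i
    exact ⟨hP.exists_isStabilizingRightInverse hn hdata i,
      hP.exists_solvesDataRegulatorEquations hn (fun z hz => (hS z hz).ge) hdata i⟩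
  · choose Xd hXd using fun i => (h i).1
    choose M hM using fun i => (h i).2
    exact ⟨_, hgain.achievesOutputSyncForData hXd hM⟩

theorem proposition3 {N r p τ : ℕ} {n m : Fin N → ℕ} (hn : ∀ i, 0 < n i)
    (net : LeaderFollowerNetwork N r p n m)
    (hS : EigenvaluesSimpleOnUnitCircle net.S)
    (hG : net.CommunicationAssumption)
    (U : ∀ i, Matrix (Fin (m i)) (Fin τ) ℝ)
    (X : ∀ i, Matrix (Fin (n i)) (Fin (τ + 1)) ℝ)
    (Abar : ∀ i, Matrix (Fin (n i)) (Fin (n i)) ℝ)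
    (Bbar : ∀ i, Matrix (Fin (n i)) (Fin (m i)) ℝ)
    (hdata : ∀ i, (Abar i, Bbar i) ∈ explainingSystems (U i) (X i)) :
    (net.InformativeForOutputSync U X ↔
      ∀ i, (∃ Xd, IsStabilizingRightInverse (X i) Xd) ∧
        ∃ M, SolvesDataRegulatorEquations net.S net.R (net.C i) (net.D i) (U i) (X i) M) ∧
    (∃ F, net.IsStabilizingGain F) ∧
    (∀ (F : Matrix (Fin r) (Fin r) ℝ) (Xd : ∀ i, Matrix (Fin τ) (Fin (n i)) ℝ)
        (M : ∀ _ : Fin N, Matrix (Fin τ) (Fin r) ℝ),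
      net.IsStabilizingGain F →
      (∀ i, IsStabilizingRightInverse (X i) (Xd i)) →
      (∀ i, SolvesDataRegulatorEquations net.S net.R (net.C i) (net.D i) (U i) (X i) (M i)) →
      net.AchievesOutputSyncForData U X
        { F := F
          K := fun i => U i * Xd i
          Pi := fun i => pastStates (X i) * M i
          Gam := fun i => U i * M i }) :=
  proposition3_general hn net (fun z hz => (hS z hz).2) hG.leaderReachesAll U X Abar Bbar hdata
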